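/- Let $d\ge 2$. A lattice in $\mathbb{R}^d$ is a discrete subgroup spanning $\mathbb{R}^d$; the space $\Omega$ of all lattices in $\mathbb{R}^d$ carries the quotient topology of $GL_d(\mathbb{R})/GL_d(\mathbb{Z})$ under $g\mapsto g\mathbb{Z}^d$. Let $A\subseteq SL_d(\mathbb{R})$ be the group of diagonal matrices with positive diagonal entries. A lattice $\Lambda\in\Omega$ is called admissible if its orbit $A\Lambda=\{a\Lambda : a\in A\}$ is precompact in $\Omega$ (has compact closure). Then: (1) There exists an admissible lattice in $\mathbb{R}^d$. (2) If $K$ is a totally real number field of degree $d$ with ring of integers $\mathcal{O}_K$, and $\phi_1,\dots,\phi_d$ are the distinct field embeddings $K\to\mathbb{R}$, then $\{(\phi_1(\alpha),\dots,\phi_d(\alpha)) : \alpha\in\mathcal{O}_K\}$ is a lattice in $\mathbb{R}^d$ and it is admissible. (3) Every admissible lattice $\Lambda$ in $\mathbb{R}^d$ is an align-Danzer set: there is $s>0$ such that $\Lambda$ intersects every aligned box $[a_1,b_1]\times\cdots\times[a_d,b_d]$ of volume $s$. -/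

import Mathlib

open scoped Matrix MatrixGroups

noncomputable section

namespace AlignDanzer

/-- A (full-rank) lattice in `ℝ^d`: a discrete additive subgroup that spans `ℝ^d` over `ℝ`.
(The space `Fin d → ℝ` is `ℝ^d` with its usual topology and Lebesgue measure.) -/
@[ext]
structure Lattice (d : ℕ) where
  /-- the underlying subgroup of `ℝ^d` -/
  carrier : Submodule ℤ (Fin d → ℝ)
  [discrete : DiscreteTopology carrier]
  [isZLattice : IsZLattice ℝ carrier]

/-- The image `g Λ = {g x | x ∈ Λ}` of a subgroup of `ℝ^d` under a matrix `g`. -/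
def image {d : ℕ} (g : GL (Fin d) ℝ) (L : Submodule ℤ (Fin d → ℝ)) :
    Submodule ℤ (Fin d → ℝ) :=
  L.map (((g : Matrix (Fin d) (Fin d) ℝ).mulVecLin).restrictScalars ℤ)

theorem mem_image {d : ℕ} {g : GL (Fin d) ℝ} {L : Submodule ℤ (Fin d → ℝ)} {y : Fin d → ℝ} :
    y ∈ image g L ↔ ∃ x ∈ L, (g : Matrix (Fin d) (Fin d) ℝ) *ᵥ x = y := by
  simp [image, Submodule.mem_map]

theorem mem_image' {d : ℕ} {g : GL (Fin d) ℝ} {L : Submodule ℤ (Fin d → ℝ)} {y : Fin d → ℝ} :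
    y ∈ image g L ↔ (g⁻¹ : GL (Fin d) ℝ).1 *ᵥ y ∈ L := by
  rw [mem_image]
  constructor
  · rintro ⟨x, hx, rfl⟩
    rw [Matrix.mulVec_mulVec, ← Units.val_mul, inv_mul_cancel, Units.val_one, Matrix.one_mulVec]
    exact hx
  · intro h
    refine ⟨_, h, ?_⟩
    rw [Matrix.mulVec_mulVec, ← Units.val_mul, mul_inv_cancel, Units.val_one, Matrix.one_mulVec]

theorem discrete_image {d : ℕ} (g : GL (Fin d) ℝ) (L : Submodule ℤ (Fin d → ℝ))
    [DiscreteTopology L] : DiscreteTopology (image g L) := by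
  have h : image g L = ZLattice.comap ℝ L ((g⁻¹ : GL (Fin d) ℝ).1.mulVecLin) := by
    ext y
    rw [mem_image']
    rfl
  rw [h]
  refine ZLattice.comap_discreteTopology ℝ L (LinearMap.continuous_of_finiteDimensional _) ?_
  exact Matrix.mulVec_injective_of_isUnit (Units.isUnit _)

theorem span_image {d : ℕ} (g : GL (Fin d) ℝ) (L : Submodule ℤ (Fin d → ℝ))
    (hL : Submodule.span ℝ (L : Set (Fin d → ℝ)) = ⊤) :
    Submodule.span ℝ (image g L : Set (Fin d → ℝ)) = ⊤ := by
  have h : (image g L : Set (Fin d → ℝ))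
      = (g : Matrix (Fin d) (Fin d) ℝ).mulVecLin '' (L : Set (Fin d → ℝ)) := rfl
  rw [h, Submodule.span_image, hL, Submodule.map_top, LinearMap.range_eq_top]
  exact Matrix.mulVec_surjective_iff_isUnit.2 (Units.isUnit g)

/-- `GL_d(ℝ)` acts on the set of lattices by `(g, Λ) ↦ g Λ`. -/
instance {d : ℕ} : MulAction (GL (Fin d) ℝ) (Lattice d) where
  smul g Λ :=
    haveI := Λ.discrete
    haveI := Λ.isZLattice
    { carrier := image g Λ.carrier
      discrete := discrete_image g Λ.carrier
      isZLattice :=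
        letI := discrete_image g Λ.carrier
        ⟨span_image g Λ.carrier IsZLattice.span_top⟩ }
  one_smul Λ := by
    refine Lattice.ext ?_
    change image 1 Λ.carrier = Λ.carrier
    ext y
    simp [mem_image]
  mul_smul g h Λ := by
    refine Lattice.ext ?_
    change image (g * h) Λ.carrier = image g (image h Λ.carrier)
    ext y
    simp [mem_image', mul_inv_rev, Matrix.mulVec_mulVec]

/-- The lattice `ℤ^d`. -/
def standardLattice (d : ℕ) : Lattice d where
  carrier := Submodule.span ℤ (Set.range (Pi.basisFun ℝ (Fin d)))

/-- The topology on the space of lattices: every lattice is `g ℤ^d` for some `g ∈ GL_d(ℝ)`, and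
the space carries the quotient topology of `GL_d(ℝ)` under `g ↦ g ℤ^d`, that is, it is
identified with `GL_d(ℝ) / GL_d(ℤ)`. -/
instance {d : ℕ} : TopologicalSpace (Lattice d) :=
  TopologicalSpace.coinduced (fun g : GL (Fin d) ℝ => g • standardLattice d) inferInstance

/-- The group `A ⊆ SL_d(ℝ)` of diagonal matrices with positive diagonal entries. -/
def posDiagonal (d : ℕ) : Subgroup (Matrix.SpecialLinearGroup (Fin d) ℝ) where
  carrier := {g | ∃ a : Fin d → ℝ, (∀ i, 0 < a i) ∧ g.1 = Matrix.diagonal a}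
  one_mem' := ⟨1, fun _ => one_pos, by simp⟩
  mul_mem' := by
    rintro g h ⟨a, ha, hg⟩ ⟨b, hb, hh⟩
    refine ⟨fun i => a i * b i, fun i => mul_pos (ha i) (hb i), ?_⟩
    change g.1 * h.1 = _
    rw [hg, hh, Matrix.diagonal_mul_diagonal]
  inv_mem' := by
    rintro g ⟨a, ha, hg⟩
    refine ⟨fun i => (a i)⁻¹, fun i => inv_pos.2 (ha i), ?_⟩
    have h1 : g.1 * (g⁻¹).1 = 1 := congrArg Subtype.val (mul_inv_cancel g)
    have h2 : Matrix.diagonal (fun i => (a i)⁻¹) * g.1 = 1 := by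
      rw [hg, Matrix.diagonal_mul_diagonal, ← Matrix.diagonal_one]
      congr 1
      funext i
      exact inv_mul_cancel₀ (ha i).ne'
    exact (left_inv_eq_right_inv h2 h1).symm

/-- The orbit `A Λ` in the space of lattices. -/
def diagonalOrbit {d : ℕ} (Λ : Lattice d) : Set (Lattice d) :=
  {Γ | ∃ a ∈ posDiagonal d, (a : GL (Fin d) ℝ) • Λ = Γ}

/-- A lattice is admissible if its orbit under `A` is precompact in the space of lattices. -/
def IsAdmissible {d : ℕ} (Λ : Lattice d) : Prop :=
  IsCompact (closure (diagonalOrbit Λ))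

/-- `D ⊆ ℝ^d` is an align-Danzer set if for some `s > 0` it intersects every aligned box
`[a₁, b₁] × ⋯ × [a_d, b_d]` of volume `s`. -/
def IsAlignDanzer {d : ℕ} (D : Set (Fin d → ℝ)) : Prop :=
  ∃ s : ℝ, 0 < s ∧ ∀ a b : Fin d → ℝ, MeasureTheory.volume (Set.Icc a b) = ENNReal.ofReal s →
    (D ∩ Set.Icc a b).Nonempty

/-- The image of the ring of integers `𝓞 K` under `Φ = (φ₁, …, φ_d) : K → ℝ^d`, for field
embeddings `φ₁, …, φ_d : K → ℝ`. -/
def minkowskiImage {d : ℕ} {K : Type*} [Field K] (φ : Fin d → (K →+* ℝ)) : Set (Fin d → ℝ) :=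
  Set.range fun (α : NumberField.RingOfIntegers K) (i : Fin d) => φ i (α : K)

end AlignDanzer

end

open scoped Matrix MatrixGroups

/-! ### The space of lattices, and align-Danzer from precompactness. -/

namespace AlignDanzer

open scoped Pointwise

variable {d : ℕ}

/-! Admissible implies align-Danzer: by compactness, all lattices in the orbit have bases with
entries below one common `n` (`IsAdmissible.exists_bound`), so each meets every cube of some fixed
size. Every aligned box with the volume of that cube is carried onto such a cube by an element of
`A`.

For a totally real field, multiplication by a unit of `𝓞 K` acts on the embedded lattice as a
diagonal matrix and preserves it. By Dirichlet's unit theorem the logarithms of units are cobounded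
in the trace-zero hyperplane (`exists_unit_abs_sub_log_le`), so each `a ∈ A` is a bounded diagonal
matrix times the square of a unit. The orbit therefore lies in the image of a compact set of
matrices, and such an image is closed.

Existence follows by adjoining to `ℚ` a root of a degree-`d` Eisenstein polynomial with `d` real
roots. -/

theorem smul_carrier (g : GL (Fin d) ℝ) (Λ : Lattice d) :
    (g • Λ).carrier = image g Λ.carrier := rfl

theorem mem_standardLattice {x : Fin d → ℝ} :
    x ∈ (standardLattice d).carrier ↔ ∀ i, ∃ n : ℤ, (n : ℝ) = x i := by
  change x ∈ Submodule.span ℤ (Set.range (Pi.basisFun ℝ (Fin d))) ↔ _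
  rw [Module.Basis.mem_span_iff_repr_mem]
  simp

theorem mem_smul_standardLattice {g : GL (Fin d) ℝ} {x : Fin d → ℝ} :
    x ∈ (g • standardLattice d).carrier ↔ ∃ n : Fin d → ℤ, g.1 *ᵥ (fun i => (n i : ℝ)) = x := by
  rw [smul_carrier, mem_image]
  constructor
  · rintro ⟨y, hy, rfl⟩
    choose n hn using mem_standardLattice.1 hy
    exact ⟨n, by rw [funext hn]⟩
  · rintro ⟨n, rfl⟩
    exact ⟨_, mem_standardLattice.2 fun i => ⟨n i, rfl⟩, rfl⟩

theorem exists_smul_standardLattice (Λ : Lattice d) :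
    ∃ g : GL (Fin d) ℝ, g • standardLattice d = Λ := by
  have := Λ.discrete
  have := Λ.isZLattice
  let b₀ : Module.Basis (Fin d) ℤ Λ.carrier := IsZLattice.basis Λ.carrier
  let b : Module.Basis (Fin d) ℝ (Fin d → ℝ) := b₀.ofZLatticeBasis ℝ Λ.carrier
  let M : Matrix (Fin d) (Fin d) ℝ := (Pi.basisFun ℝ (Fin d)).toMatrix b
  have hM : IsUnit M := by
    have := (Pi.basisFun ℝ (Fin d)).invertibleToMatrix b
    exact isUnit_of_invertible M
  have hmul : ∀ x : Fin d → ℝ, M *ᵥ x = ∑ i, x i • b i := by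
    intro x
    ext j
    simp [M, Matrix.mulVec, dotProduct, Module.Basis.toMatrix_apply, mul_comm]
  refine ⟨hM.unit, Lattice.ext (SetLike.ext fun x => ?_)⟩
  rw [mem_smul_standardLattice]
  have hspan : Submodule.span ℤ (Set.range b) = Λ.carrier :=
    b₀.ofZLatticeBasis_span ℝ
  rw [← hspan, Submodule.mem_span_range_iff_exists_fun]
  refine exists_congr fun n => ?_
  rw [IsUnit.unit_spec, hmul]
  simp only [Int.cast_smul_eq_zsmul]

theorem continuous_smul_standardLattice :
    Continuous fun g : GL (Fin d) ℝ => g • standardLattice d :=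
  continuous_coinduced_rng

/-- Fibres of the orbit map are left cosets of the stabilizer. This turns openness and closedness in
the quotient into facts about products of sets in the group. -/
theorem preimage_image_smul_standardLattice (U : Set (GL (Fin d) ℝ)) :
    (fun g : GL (Fin d) ℝ => g • standardLattice d) ⁻¹'
      ((fun g : GL (Fin d) ℝ => g • standardLattice d) '' U) =
      U * (MulAction.stabilizer (GL (Fin d) ℝ) (standardLattice d) : Set (GL (Fin d) ℝ)) := by
  ext g
  simp only [Set.mem_preimage, Set.mem_image, Set.mem_mul, SetLike.mem_coe,
    MulAction.mem_stabilizer_iff]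
  constructor
  · rintro ⟨u, hu, h⟩
    exact ⟨u, hu, u⁻¹ * g, by rw [mul_smul, ← h, inv_smul_smul], by simp⟩
  · rintro ⟨u, hu, s, hs, rfl⟩
    exact ⟨u, hu, by rw [mul_smul, hs]⟩

theorem isOpenMap_smul_standardLattice :
    IsOpenMap fun g : GL (Fin d) ℝ => g • standardLattice d := by
  intro U hU
  rw [isOpen_coinduced]
  rw [preimage_image_smul_standardLattice]
  exact hU.mul_right

/-- Integrality of all entries of `g` and `g⁻¹` is visibly a closed condition. -/
theorem mem_stabilizer_standardLattice {g : GL (Fin d) ℝ} :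
    g ∈ MulAction.stabilizer (GL (Fin d) ℝ) (standardLattice d) ↔
      (∀ i j, ∃ n : ℤ, (n : ℝ) = g.1 i j) ∧ ∀ i j, ∃ n : ℤ, (n : ℝ) = g⁻¹.1 i j := by
  have key : ∀ g : GL (Fin d) ℝ, (∀ x ∈ (standardLattice d).carrier,
      g.1 *ᵥ x ∈ (standardLattice d).carrier) ↔ ∀ i j, ∃ n : ℤ, (n : ℝ) = g.1 i j := by
    intro g
    constructor
    · intro h i j
      have := mem_standardLattice.1 (h (Pi.single j 1) (mem_standardLattice.2 fun k => by
        by_cases hk : k = j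
        · subst hk; exact ⟨1, by simp⟩
        · exact ⟨0, by simp [hk]⟩)) i
      simpa using this
    · intro h x hx
      choose m hm using h
      choose n hn using mem_standardLattice.1 hx
      refine mem_standardLattice.2 fun i => ⟨∑ j, m i j * n j, ?_⟩
      simp [Matrix.mulVec, dotProduct, hm, hn]
  rw [MulAction.mem_stabilizer_iff, ← key g, ← key g⁻¹]
  constructor
  · intro h
    refine ⟨fun x hx => ?_, fun x hx => ?_⟩
    · rw [← h]
      exact mem_image.2 ⟨x, hx, rfl⟩
    · rw [← h] at hx
      exact mem_image'.1 hx
  · rintro ⟨h₁, h₂⟩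
    refine Lattice.ext (SetLike.ext fun x => ⟨fun hx => ?_, fun hx => mem_image'.2 (h₂ x hx)⟩)
    obtain ⟨y, hy, rfl⟩ := mem_image.1 hx
    exact h₁ y hy

theorem isClosed_stabilizer_standardLattice :
    IsClosed (MulAction.stabilizer (GL (Fin d) ℝ) (standardLattice d) : Set (GL (Fin d) ℝ)) := by
  have hZ : IsClosed {x : ℝ | ∃ n : ℤ, (n : ℝ) = x} := Int.isClosedEmbedding_coe_real.isClosed_range
  have h : (MulAction.stabilizer (GL (Fin d) ℝ) (standardLattice d) : Set (GL (Fin d) ℝ)) =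
      (⋂ i, ⋂ j, {g | ∃ n : ℤ, (n : ℝ) = g.1 i j}) ∩
        ⋂ i, ⋂ j, {g | ∃ n : ℤ, (n : ℝ) = g⁻¹.1 i j} := by
    ext g
    simp only [SetLike.mem_coe, mem_stabilizer_standardLattice, Set.mem_inter_iff, Set.mem_iInter,
      Set.mem_ofPred_eq]
  rw [h]
  refine (isClosed_iInter fun i => isClosed_iInter fun j => ?_).inter
    (isClosed_iInter fun i => isClosed_iInter fun j => ?_)
  · exact hZ.preimage (Units.continuous_val.matrix_elem i j)
  · exact hZ.preimage ((Units.continuous_val.comp continuous_inv).matrix_elem i j)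

theorem isClosed_image_smul_standardLattice {C : Set (GL (Fin d) ℝ)} (hC : IsCompact C) :
    IsClosed ((fun g : GL (Fin d) ℝ => g • standardLattice d) '' C) := by
  rw [isClosed_coinduced]
  rw [preimage_image_smul_standardLattice]
  exact isClosed_stabilizer_standardLattice.mul_left_of_isCompact hC

theorem isAdmissible_of_subset_image {Λ : Lattice d} {C : Set (GL (Fin d) ℝ)} (hC : IsCompact C)
    (h : diagonalOrbit Λ ⊆ (fun g : GL (Fin d) ℝ => g • standardLattice d) '' C) :
    IsAdmissible Λ :=
  (hC.image continuous_smul_standardLattice).of_isClosed_subset isClosed_closure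
    (closure_minimal h (isClosed_image_smul_standardLattice hC))

theorem IsAdmissible.exists_bound {Λ : Lattice d} (hΛ : IsAdmissible Λ) :
    ∃ n : ℕ, ∀ Γ ∈ diagonalOrbit Λ, ∃ g : GL (Fin d) ℝ,
      (∀ i j, |g.1 i j| < n) ∧ g • standardLattice d = Γ := by
  let V : ℕ → Set (GL (Fin d) ℝ) := fun n => {g | ∀ i j, |g.1 i j| < n}
  have hV : ∀ n, IsOpen (V n) := by
    intro n
    simp only [V, Set.ofPred_forall]
    exact isOpen_iInter_of_finite fun i => isOpen_iInter_of_finite fun j =>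
      isOpen_lt (Units.continuous_val.matrix_elem i j).abs continuous_const
  have hmono : Monotone V := fun m n hmn g hg i j => (hg i j).trans_le (Nat.cast_le.2 hmn)
  -- The images of the `V n` are open, increase with `n` and cover the whole space.
  obtain ⟨n, hn⟩ := IsCompact.elim_directed_cover hΛ
    (fun n => (fun g : GL (Fin d) ℝ => g • standardLattice d) '' V n)
    (fun n => isOpenMap_smul_standardLattice _ (hV n))
    (fun Γ _ => by
      obtain ⟨g, rfl⟩ := exists_smul_standardLattice Γ
      obtain ⟨n, hn⟩ := exists_nat_gt (∑ i, ∑ j, |g.1 i j|)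
      refine Set.mem_iUnion.2 ⟨n, g, fun i j => lt_of_le_of_lt ?_ hn, rfl⟩
      refine le_trans ?_ (Finset.single_le_sum (f := fun i => ∑ j, |g.1 i j|)
        (fun i _ => Finset.sum_nonneg fun j _ => abs_nonneg _) (Finset.mem_univ i))
      exact Finset.single_le_sum (f := fun j => |g.1 i j|) (fun j _ => abs_nonneg _)
        (Finset.mem_univ j))
    (directed_of_isDirected_le fun m n hmn => Set.image_mono (hmono hmn))
  exact ⟨n, fun Γ hΓ => hn (subset_closure hΓ)⟩

/-- Round down the coordinates of `x` in the basis formed by the columns of `g`. -/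
theorem exists_mem_smul_standardLattice_abs_sub_le {g : GL (Fin d) ℝ} {c : ℝ}
    (hg : ∀ i j, |g.1 i j| ≤ c) (x : Fin d → ℝ) :
    ∃ y ∈ (g • standardLattice d).carrier, ∀ i, |y i - x i| ≤ d * c := by
  set z := g⁻¹.1 *ᵥ x with hz
  have hx : g.1 *ᵥ z = x := by
    rw [hz, Matrix.mulVec_mulVec, ← Units.val_mul, mul_inv_cancel, Units.val_one, Matrix.one_mulVec]
  refine ⟨_, mem_smul_standardLattice.2 ⟨fun i => ⌊z i⌋, rfl⟩, fun i => ?_⟩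
  rw [← Pi.sub_apply, ← hx, ← Matrix.mulVec_sub]
  calc |∑ j, g.1 i j * ((⌊z j⌋ : ℝ) - z j)| ≤ ∑ j, |g.1 i j * ((⌊z j⌋ : ℝ) - z j)| :=
        Finset.abs_sum_le_sum_abs _ _
    _ ≤ ∑ _j : Fin d, c := by
        refine Finset.sum_le_sum fun j _ => ?_
        rw [abs_mul]
        have h1 : |(⌊z j⌋ : ℝ) - z j| ≤ 1 := by
          rw [abs_le]
          constructor <;> linarith [Int.floor_le (z j), Int.lt_floor_add_one (z j)]
        calc |g.1 i j| * |(⌊z j⌋ : ℝ) - z j| ≤ |g.1 i j| * 1 := by gcongr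
          _ ≤ c := by simpa using hg i j
    _ = d * c := by simp

theorem IsAdmissible.isAlignDanzer {Λ : Lattice d} (hΛ : IsAdmissible Λ) :
    IsAlignDanzer (Λ.carrier : Set (Fin d → ℝ)) := by
  obtain ⟨n, hn⟩ := hΛ.exists_bound
  -- `d * n` is the covering radius bound; the `+ 1` only secures positivity.
  set r : ℝ := d * n + 1 with hr
  have hr0 : 0 < r := by positivity
  refine ⟨(2 * r) ^ d, by positivity, fun a b hab => ?_⟩
  rw [Real.volume_Icc_pi] at hab
  have hlt : ∀ i, 0 < b i - a i := by
    intro i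
    by_contra hi
    rw [Finset.prod_eq_zero (Finset.mem_univ i) (ENNReal.ofReal_of_nonpos (not_lt.1 hi))] at hab
    exact (ENNReal.ofReal_pos.2 (by positivity : 0 < (2 * r) ^ d)).ne hab
  rw [← ENNReal.ofReal_prod_of_nonneg fun i _ => (hlt i).le,
    ENNReal.ofReal_eq_ofReal_iff (Finset.prod_nonneg fun i _ => (hlt i).le) (by positivity)] at hab
  -- This scaling turns the box into a cube of side `2 * r`; the volume hypothesis makes its
  -- determinant 1.
  let t : Fin d → ℝ := fun i => 2 * r / (b i - a i)
  have ht : ∀ i, 0 < t i := fun i => div_pos (by positivity) (hlt i)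
  have hdet : (Matrix.diagonal t).det = 1 := by
    rw [Matrix.det_diagonal, Finset.prod_div_distrib, hab]
    simp [hr0.ne']
  let A : Matrix.SpecialLinearGroup (Fin d) ℝ := ⟨Matrix.diagonal t, hdet⟩
  obtain ⟨g, hg, hgA⟩ := hn ((A : GL (Fin d) ℝ) • Λ) ⟨A, ⟨t, ht, rfl⟩, rfl⟩
  obtain ⟨y, hy, hyx⟩ := exists_mem_smul_standardLattice_abs_sub_le (fun i j => (hg i j).le)
    (fun i => t i * ((a i + b i) / 2))
  rw [hgA] at hy
  obtain ⟨x, hx, rfl⟩ := mem_image.1 hy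
  have hcoord : ∀ i, |x i - (a i + b i) / 2| ≤ (b i - a i) / 2 := by
    intro i
    have h : t i * |x i - (a i + b i) / 2| ≤ r := by
      have h1 : (((A : GL (Fin d) ℝ) : Matrix (Fin d) (Fin d) ℝ) *ᵥ x) i = t i * x i :=
        Matrix.mulVec_diagonal t x i
      have h2 := hyx i
      rw [h1, ← mul_sub, abs_mul, abs_of_pos (ht i)] at h2
      linarith
    rw [mul_comm, ← le_div_iff₀ (ht i)] at h
    refine h.trans (le_of_eq ?_)
    have := (hlt i).ne'
    simp only [t]
    field_simp
  refine ⟨x, hx, fun i => ?_, fun i => ?_⟩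
  · linarith [(abs_le.1 (hcoord i)).1]
  · linarith [(abs_le.1 (hcoord i)).2]

end AlignDanzer

/-! ### Totally real fields: the embedded ring of integers and its units. -/

namespace AlignDanzer

open NumberField Module

variable {d : ℕ}

/-- The diagonal matrix with diagonal entries `a i`, as an element of `GL_d(ℝ)`. -/
noncomputable def diagonalGL (a : (Fin d → ℝ)ˣ) : GL (Fin d) ℝ :=
  Units.map (Matrix.diagonalRingHom (Fin d) ℝ : (Fin d → ℝ) →* Matrix (Fin d) (Fin d) ℝ) a

theorem val_diagonalGL (a : (Fin d → ℝ)ˣ) : (diagonalGL a).1 = Matrix.diagonal a.1 := rfl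

theorem continuous_diagonalGL : Continuous (diagonalGL : (Fin d → ℝ)ˣ → GL (Fin d) ℝ) :=
  Continuous.units_map _ (continuous_id.matrix_diagonal)

/-- The coordinatewise exponential, as a unit of `ℝ^d`. -/
noncomputable def expUnit (t : Fin d → ℝ) : (Fin d → ℝ)ˣ where
  val i := Real.exp (t i)
  inv i := Real.exp (-t i)
  val_inv := by ext i; simp [← Real.exp_add]
  inv_val := by ext i; simp [← Real.exp_add]

theorem continuous_expUnit : Continuous (expUnit : (Fin d → ℝ) → (Fin d → ℝ)ˣ) := by
  rw [Units.continuous_iff]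
  constructor
  · exact continuous_pi fun i => Real.continuous_exp.comp (continuous_apply i)
  · exact continuous_pi fun i => Real.continuous_exp.comp (continuous_apply i).neg

section Embeddings

variable {K : Type*} [Field K]

/-- The ring homomorphism `α ↦ (φ₁ α, …, φ_d α)` from `𝓞 K` to `ℝ^d`. -/
def ringEmbedding (φ : Fin d → (K →+* ℝ)) : 𝓞 K →+* (Fin d → ℝ) :=
  RingHom.pi fun i => (φ i).comp (algebraMap (𝓞 K) K)

theorem ringEmbedding_apply (φ : Fin d → (K →+* ℝ)) (α : 𝓞 K) (i : Fin d) :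
    ringEmbedding φ α i = φ i (α : K) := rfl

theorem minkowskiImage_eq_range (φ : Fin d → (K →+* ℝ)) :
    minkowskiImage φ = Set.range (ringEmbedding φ) := rfl

theorem diagonalGL_smul_of_unit {φ : Fin d → (K →+* ℝ)} {Λ : Lattice d}
    (hΛ : (Λ.carrier : Set (Fin d → ℝ)) = minkowskiImage φ) (u : (𝓞 K)ˣ) :
    diagonalGL (Units.map (ringEmbedding φ : 𝓞 K →* (Fin d → ℝ)) u) • Λ = Λ := by
  have hmem : ∀ x, x ∈ Λ.carrier ↔ ∃ α, ringEmbedding φ α = x := fun x => by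
    rw [← SetLike.mem_coe, hΛ]; rfl
  have hmul : ∀ α : 𝓞 K,
      (diagonalGL (Units.map (ringEmbedding φ : 𝓞 K →* (Fin d → ℝ)) u)).1 *ᵥ ringEmbedding φ α =
        ringEmbedding φ (u * α) := by
    intro α
    ext i
    rw [val_diagonalGL, Matrix.mulVec_diagonal, map_mul]
    rfl
  refine Lattice.ext (SetLike.ext fun x => ?_)
  rw [smul_carrier, mem_image]
  constructor
  · rintro ⟨y, hy, rfl⟩
    obtain ⟨α, rfl⟩ := (hmem y).1 hy
    exact (hmem _).2 ⟨_, (hmul α).symm⟩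
  · intro hx
    obtain ⟨α, rfl⟩ := (hmem x).1 hx
    exact ⟨_, (hmem _).2 ⟨(u⁻¹ : (𝓞 K)ˣ) * α, rfl⟩, by rw [hmul]; simp⟩

variable [NumberField K]

/-- Composing with `ℝ → ℂ`, injectively indexed real embeddings in number `[K : ℚ]` exhaust
the complex embeddings of `K`. -/
noncomputable def complexEmbeddingEquiv (φ : Fin d → (K →+* ℝ)) (hφ : Function.Injective φ)
    (hd : finrank ℚ K = d) : Fin d ≃ (K →+* ℂ) :=
  Equiv.ofBijective (fun i => Complex.ofRealHom.comp (φ i)) <| by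
    rw [Fintype.bijective_iff_injective_and_card, Embeddings.card K ℂ, hd, Fintype.card_fin]
    refine ⟨fun i j hij => hφ (RingHom.ext fun x => Complex.ofReal_injective ?_), rfl⟩
    exact congrArg (fun ψ : K →+* ℂ => ψ x) hij

theorem complexEmbeddingEquiv_apply {φ : Fin d → (K →+* ℝ)} {hφ : Function.Injective φ}
    {hd : finrank ℚ K = d} (i : Fin d) (x : K) :
    complexEmbeddingEquiv φ hφ hd i x = φ i x := rfl

theorem isReal_of_injective {φ : Fin d → (K →+* ℝ)} (hφ : Function.Injective φ)
    (hd : finrank ℚ K = d) (ψ : K →+* ℂ) : ComplexEmbedding.IsReal ψ := by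
  obtain ⟨i, rfl⟩ := (complexEmbeddingEquiv φ hφ hd).surjective ψ
  rw [ComplexEmbedding.isReal_iff]
  ext x
  simp [complexEmbeddingEquiv_apply]

/-- The bijection between the real embeddings and the infinite places. -/
noncomputable def infinitePlaceEquiv (φ : Fin d → (K →+* ℝ)) (hφ : Function.Injective φ)
    (hd : finrank ℚ K = d) : Fin d ≃ InfinitePlace K :=
  (complexEmbeddingEquiv φ hφ hd).trans <| Equiv.ofBijective InfinitePlace.mk <| by
    refine ⟨fun ψ χ h => ?_, fun w => ⟨w.embedding, w.mk_embedding⟩⟩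
    rcases InfinitePlace.mk_eq_iff.1 h with h | h
    · exact h
    · rwa [ComplexEmbedding.isReal_iff.1 (isReal_of_injective hφ hd ψ)] at h

theorem infinitePlaceEquiv_apply {φ : Fin d → (K →+* ℝ)} {hφ : Function.Injective φ}
    {hd : finrank ℚ K = d} (i : Fin d) (x : K) :
    infinitePlaceEquiv φ hφ hd i x = |φ i x| := by
  change ‖((φ i x : ℝ) : ℂ)‖ = _
  rw [Complex.norm_real, Real.norm_eq_abs]

theorem mult_eq_one_of_injective {φ : Fin d → (K →+* ℝ)} (hφ : Function.Injective φ)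
    (hd : finrank ℚ K = d) (w : InfinitePlace K) : w.mult = 1 :=
  InfinitePlace.IsReal.mult_eq_one (InfinitePlace.isReal_iff.2 (isReal_of_injective hφ hd _))

theorem exists_lattice_eq_minkowskiImage {φ : Fin d → (K →+* ℝ)} (hφ : Function.Injective φ)
    (hd : finrank ℚ K = d) :
    ∃ Λ : Lattice d, (Λ.carrier : Set (Fin d → ℝ)) = minkowskiImage φ := by
  let e : Free.ChooseBasisIndex ℤ (𝓞 K) ≃ Fin d := Fintype.equivFinOfCardEq <| by
    rw [← finrank_eq_card_chooseBasisIndex, RingOfIntegers.rank, hd]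
  let b : Basis (Fin d) ℤ (𝓞 K) := (RingOfIntegers.basis K).reindex e
  let bK : Basis (Fin d) ℚ K := (integralBasis K).reindex e
  have hbK : ∀ j, bK j = (b j : K) := fun j => by simp [bK, b, integralBasis_apply]
  let M : Matrix (Fin d) (Fin d) ℝ := fun i j => φ i (b j : K)
  -- The square of this determinant is the discriminant of an integral basis.
  have hdet : M.det ≠ 0 := by
    intro h
    have hdisc := Algebra.discr_eq_det_embeddingsMatrixReindex_pow_two ℚ ℂ bK
      ((complexEmbeddingEquiv φ hφ hd).trans (RingHom.equivRatAlgHom K ℂ))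
    have hmat : Algebra.embeddingsMatrixReindex ℚ ℂ bK
        ((complexEmbeddingEquiv φ hφ hd).trans (RingHom.equivRatAlgHom K ℂ)) =
        (Complex.ofRealHom.mapMatrix M)ᵀ := by
      ext j i
      change complexEmbeddingEquiv φ hφ hd i (bK j) = _
      rw [hbK]
      rfl
    rw [hmat, Matrix.det_transpose, ← RingHom.map_det, h] at hdisc
    exact Algebra.discr_not_zero_of_basis ℚ bK (by simpa using hdisc)
  let g : GL (Fin d) ℝ := ((Matrix.isUnit_iff_isUnit_det M).2 hdet.isUnit).unit
  have hg : ∀ n : Fin d → ℤ,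
      g.1 *ᵥ (fun i => (n i : ℝ)) = ringEmbedding φ (∑ j, n j • b j) := by
    intro n
    ext i
    rw [IsUnit.unit_spec, map_sum]
    simp [M, Matrix.mulVec, dotProduct, ringEmbedding_apply, mul_comm]
  refine ⟨g • standardLattice d, Set.ext fun x => ?_⟩
  rw [SetLike.mem_coe, mem_smul_standardLattice, minkowskiImage_eq_range]
  constructor
  · rintro ⟨n, rfl⟩
    exact ⟨_, (hg n).symm⟩
  · rintro ⟨α, rfl⟩
    exact ⟨b.repr α, by rw [hg, b.sum_repr]⟩

open scoped Classical in
-- The unit lattice has full rank in the log space, so subtracting a lattice point moves `v` into a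
-- bounded fundamental domain.
theorem exists_unit_norm_sub_logEmbedding_le (K : Type*) [Field K] [NumberField K] :
    ∃ R : ℝ, 0 ≤ R ∧ ∀ v : Units.dirichletUnitTheorem.logSpace K, ∃ u : (𝓞 K)ˣ,
      ‖v - Units.logEmbedding K (Additive.ofMul u)‖ ≤ R := by
  let b := (Free.chooseBasis ℤ (Units.unitLattice K)).ofZLatticeBasis ℝ (Units.unitLattice K)
  refine ⟨∑ i, ‖b i‖, Finset.sum_nonneg fun _ _ => norm_nonneg _, fun v => ?_⟩
  have hspan : Submodule.span ℤ (Set.range b) = Units.unitLattice K :=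
    (Free.chooseBasis ℤ (Units.unitLattice K)).ofZLatticeBasis_span ℝ
  have hmem : (ZSpan.floor b v : Units.dirichletUnitTheorem.logSpace K) ∈ Units.unitLattice K :=
    hspan.le (ZSpan.floor b v).2
  obtain ⟨u, -, hu⟩ := hmem
  refine ⟨Additive.toMul u, ?_⟩
  have := ZSpan.norm_fract_le b v
  rw [ZSpan.fract_apply, ← hu] at this
  exact this

theorem exists_unit_abs_sub_log_le {φ : Fin d → (K →+* ℝ)} (hφ : Function.Injective φ)
    (hd : finrank ℚ K = d) : ∃ R : ℝ, ∀ t : Fin d → ℝ, ∑ i, t i = 0 → ∃ u : (𝓞 K)ˣ,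
      ∀ i, |t i - Real.log (|φ i (u : K)|)| ≤ R := by
  classical
  obtain ⟨R, hR0, hR⟩ := exists_unit_norm_sub_logEmbedding_le K
  let e := infinitePlaceEquiv φ hφ hd
  -- The log space omits the place `w₀`. The error there is minus the sum of the others, as both `t`
  -- and the logarithms of the unit sum to zero; hence `d * R`.
  refine ⟨max R (d * R), fun t ht => ?_⟩
  obtain ⟨u, hu⟩ := hR fun w => t (e.symm w.1)
  let y : Fin d → ℝ := fun i => t i - Real.log |φ i (u : K)|
  have hy : ∀ i, e i ≠ Units.dirichletUnitTheorem.w₀ → |y i| ≤ R := by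
    intro i hi
    have h := (norm_le_pi_norm _ ⟨e i, hi⟩).trans hu
    rw [Pi.sub_apply, Units.dirichletUnitTheorem.logEmbedding_component,
      mult_eq_one_of_injective hφ hd, Equiv.symm_apply_apply, infinitePlaceEquiv_apply, Nat.cast_one,
      one_mul] at h
    exact h
  have hsum : ∑ i, y i = 0 := by
    have h := Units.sum_mult_mul_log u
    rw [← e.sum_comp] at h
    simp only [mult_eq_one_of_injective hφ hd, Nat.cast_one, one_mul, e,
      infinitePlaceEquiv_apply] at h
    simp only [y, Finset.sum_sub_distrib, ht]
    rw [h, sub_zero]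
  refine ⟨u, fun i => ?_⟩
  by_cases hi : e i = Units.dirichletUnitTheorem.w₀
  · refine le_max_of_le_right ?_
    rw [← Finset.add_sum_erase _ _ (Finset.mem_univ i), add_eq_zero_iff_eq_neg] at hsum
    change |y i| ≤ _
    rw [hsum, abs_neg]
    calc |∑ j ∈ Finset.univ.erase i, y j| ≤ ∑ j ∈ Finset.univ.erase i, |y j| :=
          Finset.abs_sum_le_sum_abs _ _
      _ ≤ ∑ j ∈ Finset.univ.erase i, R := Finset.sum_le_sum fun j hj =>
          hy j fun h => (Finset.mem_erase.1 hj).1 (e.injective (h.trans hi.symm))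
      _ ≤ ∑ j : Fin d, R :=
          Finset.sum_le_sum_of_subset_of_nonneg (Finset.erase_subset _ _) fun _ _ _ => hR0
      _ = d * R := by simp
  · exact le_max_of_le_left (hy i hi)

theorem isAdmissible_of_eq_minkowskiImage {φ : Fin d → (K →+* ℝ)} (hφ : Function.Injective φ)
    (hd : finrank ℚ K = d) {Λ : Lattice d}
    (hΛ : (Λ.carrier : Set (Fin d → ℝ)) = minkowskiImage φ) : IsAdmissible Λ := by
  obtain ⟨R, hR⟩ := exists_unit_abs_sub_log_le hφ hd
  obtain ⟨g, rfl⟩ := exists_smul_standardLattice Λ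
  let C : Set (GL (Fin d) ℝ) := (fun t => diagonalGL (expUnit t) * g) ''
    Set.Icc (fun _ => -(2 * R)) (fun _ => 2 * R)
  have hC : IsCompact C :=
    isCompact_Icc.image ((continuous_diagonalGL.comp continuous_expUnit).mul continuous_const)
  refine isAdmissible_of_subset_image hC ?_
  rintro _ ⟨A, ⟨a, ha, hA⟩, rfl⟩
  have hprod : ∏ i, a i = 1 := by
    rw [← Matrix.det_diagonal, ← hA]
    exact A.2
  -- The signs of `φ i u` are uncontrolled, so `u ^ 2` is used to get positive entries: approximate
  -- half the logarithm, at the cost of doubling `R`.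
  obtain ⟨u, hu⟩ := hR (fun i => Real.log (a i) / 2) <| by
    rw [← Finset.sum_div, ← Real.log_prod fun i _ => (ha i).ne', hprod, Real.log_one, zero_div]
  let t : Fin d → ℝ := fun i => Real.log (a i) - 2 * Real.log |φ i (u : K)|
  have ht : ∀ i, |t i| ≤ 2 * R := by
    intro i
    have h : t i = 2 * (Real.log (a i) / 2 - Real.log |φ i (u : K)|) := by simp only [t]; ring
    rw [h, abs_mul, abs_two]
    linarith [hu i]
  refine ⟨_, ⟨t, ⟨fun i => (abs_le.1 (ht i)).1, fun i => (abs_le.1 (ht i)).2⟩, rfl⟩, ?_⟩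
  have hfac : (A : GL (Fin d) ℝ) = diagonalGL (expUnit t) *
      diagonalGL (Units.map (ringEmbedding φ : 𝓞 K →* (Fin d → ℝ)) (u ^ 2)) := by
    refine Units.ext ?_
    rw [Units.val_mul, val_diagonalGL, val_diagonalGL, Matrix.diagonal_mul_diagonal]
    refine hA.trans (congrArg Matrix.diagonal (funext fun i => ?_))
    have hne : φ i (u : K) ≠ 0 := (map_ne_zero _).2 (Units.coe_ne_zero u)
    have hval : (Units.map (ringEmbedding φ : 𝓞 K →* (Fin d → ℝ)) (u ^ 2)).1 i =
        |φ i (u : K)| ^ 2 := by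
      rw [sq_abs, map_pow, Units.val_pow_eq_pow_val, Pi.pow_apply]
      rfl
    rw [hval]
    change _ = Real.exp (t i) * _
    rw [Real.exp_sub, Real.exp_log (ha i), two_mul, Real.exp_add,
      Real.exp_log (abs_pos.2 hne)]
    have := (abs_pos.2 hne).ne'
    field_simp
  change (diagonalGL (expUnit t) * g) • standardLattice d = _
  rw [hfac, mul_smul, mul_smul, diagonalGL_smul_of_unit hΛ]

end Embeddings

end AlignDanzer

/-! ### A degree-`d` number field with `d` real embeddings. -/

namespace AlignDanzer

open Polynomial

/-- The polynomial `X (X - 4) ⋯ (X - 4 (d - 1)) + 2`. -/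
noncomputable def shiftedProduct (d : ℕ) : ℤ[X] :=
  ∏ i ∈ Finset.range d, (X - C (4 * (i : ℤ))) + C 2

theorem monic_prod_X_sub (d : ℕ) :
    (∏ i ∈ Finset.range d, (X - C (4 * (i : ℤ)))).Monic :=
  monic_prod_of_monic _ _ fun _ _ => monic_X_sub_C _

theorem degree_prod_X_sub (d : ℕ) :
    (∏ i ∈ Finset.range d, (X - C (4 * (i : ℤ)))).degree = (d : WithBot ℕ) := by
  rw [degree_prod_of_monic _ _ fun _ _ => monic_X_sub_C _]
  simp_rw [degree_X_sub_C]
  simp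

theorem degree_shiftedProduct {d : ℕ} (hd : 1 ≤ d) : (shiftedProduct d).degree = d := by
  rw [shiftedProduct, degree_add_eq_left_of_degree_lt, degree_prod_X_sub]
  rw [degree_prod_X_sub]
  exact degree_C_le.trans_lt (by exact_mod_cast hd)

theorem monic_shiftedProduct {d : ℕ} (hd : 1 ≤ d) : (shiftedProduct d).Monic := by
  refine (monic_prod_X_sub d).add_of_left ?_
  rw [degree_prod_X_sub]
  exact degree_C_le.trans_lt (by exact_mod_cast hd)

/-- Eisenstein at 2: the roots of the product are even, and the factor `X` makes the constant term
exactly 2. -/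
theorem irreducible_shiftedProduct {d : ℕ} (hd : 1 ≤ d) : Irreducible (shiftedProduct d) := by
  have hmod : (shiftedProduct d).map (Int.castRingHom (ZMod 2)) = X ^ d := by
    have h2 : (2 : (ZMod 2)[X]) = 0 := CharTwo.two_eq_zero
    have h4 : (4 : (ZMod 2)[X]) = 0 := by
      rw [show (4 : (ZMod 2)[X]) = 2 * 2 by norm_num, h2, zero_mul]
    simp [shiftedProduct, Polynomial.map_prod, h2, h4]
  refine irreducible_of_eisenstein_criterion (P := Ideal.span {(2 : ℤ)})
    ((Ideal.span_singleton_prime two_ne_zero).2 Int.prime_two) ?_ ?_ ?_ ?_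
    (monic_shiftedProduct hd).isPrimitive
  · rw [(monic_shiftedProduct hd).leadingCoeff, Ideal.mem_span_singleton]
    norm_num
  · intro n hn
    rw [degree_shiftedProduct hd] at hn
    have hn' : n ≠ d := fun h => absurd hn (by simp [h])
    have h := congrArg (fun p => p.coeff n) hmod
    simp only [coeff_map, coeff_X_pow, if_neg hn'] at h
    rw [Ideal.mem_span_singleton]
    exact (ZMod.intCast_zmod_eq_zero_iff_dvd _ 2).1 h
  · rw [degree_shiftedProduct hd]
    exact_mod_cast hd
  · have h0 : (shiftedProduct d).coeff 0 = 2 := by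
      rw [coeff_zero_eq_eval_zero, shiftedProduct, eval_add, eval_C, eval_prod,
        Finset.prod_eq_zero (Finset.mem_range.2 hd) (by simp), zero_add]
    rw [h0, Ideal.span_singleton_pow, Ideal.mem_span_singleton]
    norm_num

theorem eval_shiftedProduct (d : ℕ) (x : ℝ) :
    aeval x (shiftedProduct d) = ∏ j ∈ Finset.range d, (x - 4 * (j : ℝ)) + 2 := by
  simp only [shiftedProduct, map_add, map_prod, map_sub, aeval_X, aeval_C]
  simp

/-- At `4 * i - 2` every factor has absolute value at least 2 and exactly `d - i` are negative. The
product has size at least `2 ^ d ≥ 4`, so adding 2 cannot change its sign. -/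
theorem pow_mul_eval_shiftedProduct_pos {d i : ℕ} (hd : 2 ≤ d) (hi : i ≤ d) :
    0 < (-1 : ℝ) ^ (d - i) * aeval (4 * (i : ℝ) - 2) (shiftedProduct d) := by
  have hprod : (2 : ℝ) ^ d ≤
      (-1) ^ (d - i) * ∏ j ∈ Finset.range d, (4 * (i : ℝ) - 2 - 4 * (j : ℝ)) := by
    have hsign : (-1 : ℝ) ^ (d - i) = ∏ j ∈ Finset.range d, if j < i then (1 : ℝ) else -1 := by
      rw [← Finset.prod_range_mul_prod_Ico _ hi, Finset.prod_congr rfl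
        (fun j hj => if_pos (Finset.mem_range.1 hj)), Finset.prod_congr (s₁ := Finset.Ico i d) rfl
        (fun j hj => if_neg (not_lt.2 (Finset.mem_Ico.1 hj).1))]
      simp
    rw [hsign, ← Finset.prod_mul_distrib]
    calc (2 : ℝ) ^ d = ∏ _j ∈ Finset.range d, (2 : ℝ) := by simp
      _ ≤ _ := by
        refine Finset.prod_le_prod (fun _ _ => by norm_num) fun j _ => ?_
        split_ifs with h
        · have : (j : ℝ) + 1 ≤ i := by exact_mod_cast h
          linarith
        · have : (i : ℝ) ≤ j := by exact_mod_cast not_lt.1 h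
          linarith
  have h4 : (4 : ℝ) ≤ 2 ^ d := by
    calc (4 : ℝ) = 2 ^ 2 := by norm_num
      _ ≤ 2 ^ d := pow_le_pow_right₀ (by norm_num) hd
  rw [eval_shiftedProduct, mul_add]
  rcases neg_one_pow_eq_or ℝ (d - i) with h | h <;> rw [h] at hprod ⊢ <;> linarith

theorem exists_root_shiftedProduct {d i : ℕ} (hd : 2 ≤ d) (hi : i < d) :
    ∃ x : ℝ, 4 * (i : ℝ) - 2 < x ∧ x < 4 * (i : ℝ) + 2 ∧ aeval x (shiftedProduct d) = 0 := by
  have h₀ := pow_mul_eval_shiftedProduct_pos hd hi.le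
  have h₁ := pow_mul_eval_shiftedProduct_pos hd (Nat.succ_le_of_lt hi)
  rw [show d - i = d - (i + 1) + 1 by omega, pow_succ] at h₀
  rw [Nat.cast_add_one, show 4 * ((i : ℝ) + 1) - 2 = 4 * i + 2 by ring] at h₁
  have hcont : ContinuousOn (fun x : ℝ => (-1) ^ (d - (i + 1)) * aeval x (shiftedProduct d))
      (Set.Icc (4 * (i : ℝ) - 2) (4 * i + 2)) :=
    (continuous_const.mul (shiftedProduct d).continuous_aeval).continuousOn
  obtain ⟨x, hx, hx0⟩ := intermediate_value_Ioo (by linarith) hcont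
    (show (0 : ℝ) ∈ _ from ⟨by linarith, h₁⟩)
  exact ⟨x, hx.1, hx.2, (mul_eq_zero.1 hx0).resolve_left (by simp)⟩

/-- The sign changes put one root in each of `d` disjoint intervals. -/
theorem exists_injective_roots_shiftedProduct {d : ℕ} (hd : 2 ≤ d) :
    ∃ r : Fin d → ℝ, Function.Injective r ∧ ∀ i, aeval (r i) (shiftedProduct d) = 0 := by
  choose r h₁ h₂ h₃ using fun i : Fin d => exists_root_shiftedProduct hd i.2
  refine ⟨r, StrictMono.injective fun i j hij => ?_, h₃⟩
  have : ((i : ℕ) : ℝ) + 1 ≤ (j : ℕ) := by exact_mod_cast hij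
  linarith [h₂ i, h₁ j]

theorem exists_numberField_injective_real_embeddings {d : ℕ} (hd : 2 ≤ d) :
    ∃ (K : Type) (_ : Field K) (_ : NumberField K) (φ : Fin d → (K →+* ℝ)),
      Module.finrank ℚ K = d ∧ Function.Injective φ := by
  obtain ⟨r, hinj, hr⟩ := exists_injective_roots_shiftedProduct hd
  have hd1 : 1 ≤ d := by omega
  have hmon := monic_shiftedProduct hd1
  let f : ℚ[X] := (shiftedProduct d).map (Int.castRingHom ℚ)
  have hirr : Irreducible f :=
    (IsPrimitive.Int.irreducible_iff_irreducible_map_cast hmon.isPrimitive).1 (irreducible_shiftedProduct hd1)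
  have : Fact (Irreducible f) := ⟨hirr⟩
  have : FiniteDimensional ℚ (AdjoinRoot f) := (AdjoinRoot.powerBasis hirr.ne_zero).finite
  have : CharZero (AdjoinRoot f) := algebraRat.charZero _
  have hroot : ∀ i, f.eval₂ (algebraMap ℚ ℝ) (r i) = 0 := fun i => by
    rw [← aeval_def]
    exact (aeval_map_algebraMap ℚ (r i) (shiftedProduct d)).trans (hr i)
  refine ⟨AdjoinRoot f, inferInstance, ⟨⟩,
    fun i => AdjoinRoot.lift (algebraMap ℚ ℝ) (r i) (hroot i), ?_, fun i j hij => hinj ?_⟩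
  · rw [(AdjoinRoot.powerBasis hirr.ne_zero).finrank, AdjoinRoot.powerBasis_dim,
      hmon.natDegree_map, natDegree_eq_of_degree_eq_some (degree_shiftedProduct hd1)]
  · have := congrArg (fun ψ : AdjoinRoot f →+* ℝ => ψ (AdjoinRoot.root f)) hij
    simpa using this

end AlignDanzer

theorem theorem2 (d : ℕ) (hd : 2 ≤ d) :
    (∃ Λ : AlignDanzer.Lattice d, AlignDanzer.IsAdmissible Λ) ∧
    (∀ (K : Type*) [Field K] [NumberField K] [NumberField.IsTotallyReal K],
      Module.finrank ℚ K = d →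
      ∀ φ : Fin d → (K →+* ℝ), Function.Bijective φ →
        ∃ Λ : AlignDanzer.Lattice d,
          (Λ.carrier : Set (Fin d → ℝ)) = AlignDanzer.minkowskiImage φ ∧
          AlignDanzer.IsAdmissible Λ) ∧
    (∀ Λ : AlignDanzer.Lattice d, AlignDanzer.IsAdmissible Λ →
      AlignDanzer.IsAlignDanzer (Λ.carrier : Set (Fin d → ℝ))) := by
  refine ⟨?_, ?_, fun Λ hΛ => hΛ.isAlignDanzer⟩
  · obtain ⟨K, _, _, φ, hK, hφ⟩ := AlignDanzer.exists_numberField_injective_real_embeddings hd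
    obtain ⟨Λ, hΛ⟩ := AlignDanzer.exists_lattice_eq_minkowskiImage hφ hK
    exact ⟨Λ, AlignDanzer.isAdmissible_of_eq_minkowskiImage hφ hK hΛ⟩
  · intro K _ _ _ hK φ hφ
    obtain ⟨Λ, hΛ⟩ := AlignDanzer.exists_lattice_eq_minkowskiImage hφ.injective hK
    exact ⟨Λ, hΛ, AlignDanzer.isAdmissible_of_eq_minkowskiImage hφ.injective hK hΛ⟩
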